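/- Let $n\ge 2$ and let $\mathbb{R}^{2,n}$ be $\mathbb{R}^{n+2}$ with the quadratic form $q(u_1,u_2,x_1,\dots,x_n)=-u_1^2-u_2^2+x_1^2+\dots+x_n^2$ and its polar bilinear form $\langle\cdot|\cdot\rangle$. Put $\mathrm{AdS}_{n+1}=\{q=-1\}$, let $\mathbb{S}(\mathbb{R}^{2,n})$ be the space of rays (nonzero vectors up to positive scaling), and let $\mathrm{Ein}_n=\partial \mathrm{AdS}_{n+1}\subset\mathbb{S}(\mathbb{R}^{2,n})$ be the set of isotropic rays, covered by $\mathbb{R}\times\mathbb{S}^{n-1}$ (with the conformal class of $-d\theta^2+ds^2$) through $(\theta,x)\mapsto[\cos\theta,\sin\theta,x]$. A subset of $\mathrm{Ein}_n$ is acausal if it is the projection of a subset of $\mathbb{R}\times\mathbb{S}^{n-1}$ no two distinct points of which are joined by a causal curve. Let $\Gamma$ be a group and let $\rho:\Gamma\to \mathrm{SO}_0(2,n)$ be a quasi-Fuchsian (GHC-regular) representation with acausal limit set $\Lambda_\rho$: that is, $\rho$ is faithful and discrete, and $\Lambda_\rho\subset\mathrm{Ein}_n$ is a $\rho(\Gamma)$-invariant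 acausal subset homeomorphic to $\mathbb{S}^{n-1}$. Let $\mathrm{Conv}(\Lambda_\rho)\subset\mathbb{S}(\mathbb{R}^{2,n})$ be the convex hull of $\Lambda_\rho$, i.e. the set of rays spanned by the barycentric combinations $t_1x_1+\dots+t_kx_k$ ($t_i>0$, $\sum t_i=1$) of nonzero vectors $x_i$ whose rays belong to $\Lambda_\rho$. If $\mathrm{Conv}(\Lambda_\rho)$ has empty interior in $\mathbb{S}(\mathbb{R}^{2,n})$, then $\rho$ is Fuchsian, i.e. it is a faithful discrete representation with values in the stabilizer of a point of $\mathrm{AdS}_{n+1}$. More precisely, there is $v\in\mathrm{AdS}_{n+1}$ such that $\rho(\gamma)v=v$ for all $\gamma\in\Gamma$, the totally geodesic hypersurface $v^\perp\cap\mathrm{AdS}_{n+1}$ is spacelike, and $\mathrm{Conv}(\Lambda_\rho)\subset\mathbb{S}(v^\perp)$. -/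

import Mathlib

open scoped Pointwise Matrix

namespace AdS

/-- The vector space underlying `ℝ^{2,n}`: two negative coordinates, then `n` positive ones. -/
abbrev R2n (n : ℕ) : Type := Fin 2 ⊕ Fin n → ℝ

/-- The bilinear form of `ℝ^{2,n}`, polar to `q_{2,n} = -u² - v² + x₁² + ⋯ + xₙ²`. -/
def form {n : ℕ} (x y : R2n n) : ℝ :=
  -(∑ i, x (Sum.inl i) * y (Sum.inl i)) + ∑ j, x (Sum.inr j) * y (Sum.inr j)

/-- The quadratic form `q_{2,n}`. -/
def quad {n : ℕ} (x : R2n n) : ℝ := form x x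

/-- Anti-de Sitter space `AdS_{n+1} = {q_{2,n} = -1}`. -/
def adsSpace (n : ℕ) : Set (R2n n) := {x | quad x = -1}

/-- `SO(2,n)`: matrices of determinant one that preserve the form of `ℝ^{2,n}`. -/
def SO2n (n : ℕ) : Subgroup (GL (Fin 2 ⊕ Fin n) ℝ) where
  carrier := {g | (∀ x y, form (g.1 *ᵥ x) (g.1 *ᵥ y) = form x y) ∧ g.1.det = 1}
  one_mem' := by simp
  mul_mem' := by
    rintro a b ⟨ha, ha'⟩ ⟨hb, hb'⟩
    refine ⟨fun x y => ?_, ?_⟩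
    · simp only [Units.val_mul, ← Matrix.mulVec_mulVec, ha, hb]
    · simp only [Units.val_mul, Matrix.det_mul, ha', hb', mul_one]
  inv_mem' := by
    rintro a ⟨ha, ha'⟩
    have key : ∀ x, a.1 *ᵥ ((a⁻¹).1 *ᵥ x) = x := fun x => by
      rw [Matrix.mulVec_mulVec, ← Units.val_mul, mul_inv_cancel, Units.val_one,
        Matrix.one_mulVec]
    refine ⟨fun x y => ?_, ?_⟩
    · rw [← ha, key, key]
    · have h : (a.1 * (a⁻¹).1).det = 1 := by
        rw [← Units.val_mul, mul_inv_cancel, Units.val_one, Matrix.det_one]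
      rwa [Matrix.det_mul, ha', one_mul] at h

/-- `SO₀(2,n)`: the identity component of `SO(2,n)`. -/
def SO2nZero (n : ℕ) : Subgroup (GL (Fin 2 ⊕ Fin n) ℝ) :=
  (Subgroup.connectedComponentOfOne (SO2n n)).map (SO2n n).subtype

/-- The sphere of rays `𝕊(ℝ^{2,n})`: nonzero vectors up to positive homotheties. -/
abbrev RaySphere (n : ℕ) : Type := Module.Ray ℝ (R2n n)

/-- The quotient topology on the sphere of rays. -/
instance (n : ℕ) : TopologicalSpace (RaySphere n) :=
  TopologicalSpace.coinduced
    (fun v : {v : R2n n // v ≠ 0} => rayOfNeZero ℝ v.1 v.2) inferInstance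

/-- The unit sphere `𝕊^{n-1}` of `ℝⁿ`. -/
abbrev UnitSphere (n : ℕ) : Type := Metric.sphere (0 : EuclideanSpace ℝ (Fin n)) 1

/-- The isotropic vector `(cos θ, sin θ, x)`. -/
noncomputable def einVector {n : ℕ} (P : ℝ × UnitSphere n) : R2n n :=
  Sum.elim ![Real.cos P.1, Real.sin P.1] (fun j => P.2.1 j)

lemma einVector_ne_zero {n : ℕ} (P : ℝ × UnitSphere n) : einVector P ≠ 0 := by
  intro h
  have h0 : Real.cos P.1 = 0 := by simpa [einVector] using congrFun h (Sum.inl 0)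
  have h1 : Real.sin P.1 = 0 := by simpa [einVector] using congrFun h (Sum.inl 1)
  have := Real.sin_sq_add_cos_sq P.1
  simp [h0, h1] at this

/-- The covering map from `ℝ × 𝕊^{n-1}`, with the conformal class of `-dθ² + ds²`, onto the
Einstein universe `Ein_n = ∂AdS_{n+1}`, the set of isotropic rays of `ℝ^{2,n}`. -/
noncomputable def einProj {n : ℕ} (P : ℝ × UnitSphere n) : RaySphere n :=
  rayOfNeZero ℝ (einVector P) (einVector_ne_zero P)

/-- There is a `C¹` causal curve from `P` to `Q` in `(ℝ × 𝕊^{n-1}, -dθ² + ds²)`: its velocity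
is everywhere nonzero and of nonpositive norm. -/
def CausallyJoined {n : ℕ} (P Q : ℝ × UnitSphere n) : Prop :=
  ∃ (θ : ℝ → ℝ) (x : ℝ → EuclideanSpace ℝ (Fin n)),
    ContDiff ℝ 1 θ ∧ ContDiff ℝ 1 x ∧
    (∀ t ∈ Set.Icc (0 : ℝ) 1, ‖x t‖ = 1) ∧
    (∀ t ∈ Set.Icc (0 : ℝ) 1,
      (deriv θ t, deriv x t) ≠ 0 ∧ -(deriv θ t) ^ 2 + ‖deriv x t‖ ^ 2 ≤ 0) ∧
    θ 0 = P.1 ∧ x 0 = P.2 ∧ θ 1 = Q.1 ∧ x 1 = Q.2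

/-- A subset of `Ein_n` is acausal if it is the projection of a subset of `ℝ × 𝕊^{n-1}`
no two distinct points of which are joined by a causal curve. -/
def IsAcausal {n : ℕ} (Λ : Set (RaySphere n)) : Prop :=
  ∃ L : Set (ℝ × UnitSphere n),
    (∀ P ∈ L, ∀ Q ∈ L, P ≠ Q → ¬ CausallyJoined P Q) ∧ einProj '' L = Λ

/-- `Conv(Λ) = 𝕊(C)`, where `C` is the set of barycentric combinations of vectors whose rays
belong to `Λ`. -/
def conv {n : ℕ} (Λ : Set (RaySphere n)) : Set (RaySphere n) :=
  {r | ∃ (v : R2n n) (hv : v ≠ 0),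
    v ∈ convexHull ℝ {x : R2n n | ∃ hx : x ≠ 0, rayOfNeZero ℝ x hx ∈ Λ} ∧
    r = rayOfNeZero ℝ v hv}

/-- The projective hyperplane `𝕊(v^⊥)`. -/
def rayPerp {n : ℕ} (v : R2n n) : Set (RaySphere n) :=
  {r | ∃ (x : R2n n) (hx : x ≠ 0), form v x = 0 ∧ r = rayOfNeZero ℝ x hx}

/-- The totally geodesic hypersurface `v^⊥ ∩ AdS_{n+1}` is spacelike: the form is positive
definite on its tangent spaces. -/
def IsSpacelikePerp {n : ℕ} (v : R2n n) : Prop :=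
  ∀ x ∈ adsSpace n, form v x = 0 →
    ∀ w : R2n n, form v w = 0 → form x w = 0 → w ≠ 0 → 0 < quad w

/-- `ρ` is quasi-Fuchsian (GHC-regular) with acausal limit set `Λ`: it is faithful and discrete,
and `Λ` is an acausal topological `(n-1)`-sphere in `Ein_n` preserved by `ρ(Γ)`. -/
structure IsQuasiFuchsian {n : ℕ} {Γ : Type*} [Group Γ] (ρ : Γ →* SO2nZero n)
    (Λ : Set (RaySphere n)) : Prop where
  faithful : Function.Injective ρ
  discrete : DiscreteTopology ρ.range
  sphere : Nonempty (Λ ≃ₜ UnitSphere n)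
  acausal : IsAcausal Λ
  invariant : ∀ γ, Matrix.GeneralLinearGroup.toLin (ρ γ : GL (Fin 2 ⊕ Fin n) ℝ) • Λ = Λ

/-- `v` is a point of `AdS_{n+1}` fixed by `ρ(Γ)`. -/
def IsGlobalFixedPoint {n : ℕ} {Γ : Type*} [Group Γ] (ρ : Γ →* SO2nZero n) (v : R2n n) : Prop :=
  v ∈ adsSpace n ∧ ∀ γ, (ρ γ : GL (Fin 2 ⊕ Fin n) ℝ).1 *ᵥ v = v

/-- `ρ` is Fuchsian: faithful, discrete, with values in the stabilizer (a copy of `SO₀(1,n)`)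
of a point of `AdS_{n+1}`. -/
def IsFuchsian {n : ℕ} {Γ : Type*} [Group Γ] (ρ : Γ →* SO2nZero n) : Prop :=
  Function.Injective ρ ∧ DiscreteTopology ρ.range ∧ ∃ v, IsGlobalFixedPoint ρ v

end AdS

/-! If the hull has empty interior, the vectors of `Λ` do not span, so some `v ≠ 0` is orthogonal to
`Λ`. Everything rests on `v` being timelike (`quad_neg_of_orthogonal_cone`). Acausality makes the
form negative on vectors of distinct rays of `Λ`. If `v` were not timelike, project the positive
parts of these vectors to the orthogonal of the positive part of `v` in `ℝⁿ` and normalize. Two rays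
with the same image would give a difference orthogonal to `v` whose positive part is parallel to
that of `v`: it cannot be spacelike, yet acausality makes it so. Hence an `(n-1)`-sphere would
inject continuously into an `(n-2)`-sphere.

By the signature, the vectors orthogonal to `Λ` then form a timelike line, which `ρ(Γ)` preserves.
So `v`, once normalized, is sent to `±v`. The sign is `+` because `SO₀(2,n)` preserves the
orientation of negative definite planes, while the form is nonpositive on pairs of vectors of `Λ`.

The topological input, that a continuous injection cannot lower dimension, is proved analytically.
For `u` supported in the unit ball, a Jacobian integral along `x ↦ x + t u(x)` is polynomial in `t`
and constant for small `t`, hence equal at `t = 0` and `t = 1`. -/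

/-! ### Continuous injections do not lower dimension -/

section Topology

open MeasureTheory Metric Set Polynomial

/-- A perturbation of the identity by a contraction is bijective. -/
lemma bijective_add_of_lipschitzWith {E : Type*} [NormedAddCommGroup E] [CompleteSpace E]
    {w : E → E} {K : NNReal} (hK : K < 1) (hw : LipschitzWith K w) :
    Function.Bijective fun x => x + w x := by
  -- The preimages of `y` are the fixed points of the contraction `x ↦ y - w x`.
  have hc : ∀ y, ContractingWith K fun x => y - w x := fun y =>
    ⟨hK, LipschitzWith.of_dist_le_mul fun a b => by
      rw [dist_sub_left]; exact hw.dist_le_mul a b⟩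
  refine ⟨fun a b hab => ?_, fun y => ⟨(hc y).fixedPoint, ?_⟩⟩
  · refine (hc (a + w a)).fixedPoint_unique' (x := a) (y := b) ?_ ?_
    · simp [Function.IsFixedPt]
    · have hab' : a + w a = b + w b := hab
      simp [Function.IsFixedPt, hab']
  · have := (hc y).fixedPoint_isFixedPt
    have h2 : y - w (hc y).fixedPoint = (hc y).fixedPoint := this
    exact eq_sub_iff_add_eq.1 h2.symm

variable {k : ℕ}

local notation "𝔼" => EuclideanSpace ℝ (Fin k)

/-- The integrand of the change of variables formula along `x ↦ x + t u(x)` is a polynomial in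
`t` with continuous coefficients. -/
lemma exists_polynomial_eval_eq {u : 𝔼 → 𝔼} (hu : ContDiff ℝ 1 u) (p : ℝ[X]) :
    ∃ P : C(𝔼, ℝ)[X], ∀ (t : ℝ) (x : 𝔼),
      p.eval (‖x + t • u x‖ ^ 2) * (ContinuousLinearMap.id ℝ 𝔼 + t • fderiv ℝ u x).det =
        ∑ i ∈ Finset.range (P.natDegree + 1), P.coeff i x * t ^ i := by
  have hcont := hu.continuous_fderiv one_ne_zero
  have huc := hu.continuous
  let cu : Fin k → C(𝔼, ℝ) := fun i => ⟨fun x => u x i, by fun_prop⟩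
  let cx : Fin k → C(𝔼, ℝ) := fun i => ⟨fun x => x i, by fun_prop⟩
  let M : Matrix (Fin k) (Fin k) C(𝔼, ℝ) := fun i j =>
    ⟨fun x => fderiv ℝ u x (EuclideanSpace.single j 1) i, by
      have : Continuous fun x => fderiv ℝ u x (EuclideanSpace.single j 1) :=
        hcont.clm_apply continuous_const
      fun_prop⟩
  let N : C(𝔼, ℝ)[X] := ∑ i, (C (cx i) + X * C (cu i)) ^ 2
  let D : Matrix (Fin k) (Fin k) C(𝔼, ℝ)[X] := 1 + M.map fun m => X * C m
  refine ⟨aeval N p * D.det, fun t x => ?_⟩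
  let ev : C(𝔼, ℝ) →+* ℝ := (Pi.evalRingHom (fun _ : 𝔼 => ℝ) x).comp ContinuousMap.coeFnRingHom
  let φ : C(𝔼, ℝ)[X] →+* ℝ := eval₂RingHom ev t
  have hφ : ∀ P : C(𝔼, ℝ)[X],
      φ P = ∑ i ∈ Finset.range (P.natDegree + 1), P.coeff i x * t ^ i := fun P => by
    simp only [φ, coe_eval₂RingHom, eval₂_eq_sum_range]; rfl
  have hφC : ∀ c, φ (C c) = c x := fun c => by simp [φ, ev]
  have hφX : φ X = t := by simp [φ]
  rw [← hφ, map_mul]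
  congr 1
  · have hN : φ N = ‖x + t • u x‖ ^ 2 := by
      simp only [N, map_sum, map_pow, map_add, map_mul, hφC, hφX, EuclideanSpace.norm_sq_eq]
      exact Finset.sum_congr rfl fun i _ => by simp [cx, cu]
    -- The identity is the only ring endomorphism of `ℝ`, so `φ` fixes the scalars.
    rw [aeval_def, hom_eval₂, hN, Subsingleton.elim (φ.comp _) (RingHom.id ℝ)]
    rfl
  · rw [RingHom.map_det, ContinuousLinearMap.det,
      ← LinearMap.det_toMatrix (EuclideanSpace.basisFun (Fin k) ℝ).toBasis]
    congr 1
    ext i j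
    have hM : φ ((M.map fun m => X * C m) i j) = t * M i j x := by
      rw [Matrix.map_apply, map_mul, hφX, hφC]
    have hD : φ.mapMatrix D i j = φ ((1 : Matrix (Fin k) (Fin k) C(𝔼, ℝ)[X]) i j) +
        φ ((M.map fun m => X * C m) i j) := map_add φ _ _
    rw [hD, hM]
    simp [LinearMap.toMatrix_apply, Matrix.one_apply, M, apply_ite φ]

/-- For small `t`, `x ↦ x + t u(x)` is a bijection of the ball with positive Jacobian, so the change
of variables formula applies. The integral is polynomial in `t`, so its value persists at `t = 1`,
where the map need not be injective. -/
lemma integral_comp_add_eq {u : 𝔼 → 𝔼} (hu : ContDiff ℝ 1 u)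
    (hu0 : ∀ x, x ∉ closedBall (0 : 𝔼) 1 → u x = 0) (p : ℝ[X]) :
    ∫ x in closedBall (0 : 𝔼) 1,
        p.eval (‖x + u x‖ ^ 2) * (ContinuousLinearMap.id ℝ 𝔼 + fderiv ℝ u x).det =
      ∫ x in closedBall (0 : 𝔼) 1, p.eval (‖x‖ ^ 2) := by
  have hB : IsCompact (closedBall (0 : 𝔼) 1) := isCompact_closedBall _ _
  obtain ⟨P, hP⟩ := exists_polynomial_eval_eq hu p
  obtain ⟨K, hK⟩ := hu.lipschitzWith_of_hasCompactSupport (HasCompactSupport.intro hB hu0)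
    one_ne_zero
  have hcont := hu.continuous_fderiv one_ne_zero
  let J : ℝ[X] := ∑ i ∈ Finset.range (P.natDegree + 1),
    C (∫ x in closedBall (0 : 𝔼) 1, P.coeff i x) * X ^ i
  have hJ : ∀ t : ℝ, J.eval t = ∫ x in closedBall (0 : 𝔼) 1, p.eval (‖x + t • u x‖ ^ 2) *
      (ContinuousLinearMap.id ℝ 𝔼 + t • fderiv ℝ u x).det := by
    intro t
    simp_rw [hP]
    rw [integral_finsetSum]
    · simp [J, eval_finsetSum, integral_mul_const]
    · intro i _
      exact ((P.coeff i).continuous.mul continuous_const).continuousOn.integrableOn_compact hB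
  have hdet : ∀ᶠ t : ℝ in nhds 0, ∀ x ∈ closedBall (0 : 𝔼) 1,
      0 < (ContinuousLinearMap.id ℝ 𝔼 + t • fderiv ℝ u x).det := by
    refine hB.eventually_forall_of_forall_eventually fun x _ => ?_
    have hc : Continuous fun z : ℝ × 𝔼 =>
        (ContinuousLinearMap.id ℝ 𝔼 + z.1 • fderiv ℝ u z.2).det :=
      ContinuousLinearMap.continuous_det.comp (by fun_prop)
    refine (hc.tendsto (0, x)).eventually (lt_mem_nhds ?_)
    simp [ContinuousLinearMap.det]
  have hsmall : ∀ᶠ t : ℝ in nhds 0, ‖t‖₊ * K < 1 := by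
    have hc : Continuous fun t : ℝ => ‖t‖₊ * K := by fun_prop
    exact (hc.tendsto 0).eventually (gt_mem_nhds (by simp))
  have hloc : ∀ᶠ t : ℝ in nhds 0, J.eval t = ∫ x in closedBall (0 : 𝔼) 1, p.eval (‖x‖ ^ 2) := by
    filter_upwards [hdet, hsmall] with t ht1 ht2
    have hlip : LipschitzWith (‖t‖₊ * K) fun x => t • u x :=
      (lipschitzWith_smul t).comp hK
    have hbij := bijective_add_of_lipschitzWith ht2 hlip
    have himg : (fun x => x + t • u x) '' closedBall (0 : 𝔼) 1 = closedBall 0 1 := by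
      apply Subset.antisymm
      · rintro _ ⟨x, hx, rfl⟩
        by_contra hy
        -- A point outside the ball is fixed by the map; by injectivity it is not the image of any
        -- other point.
        have : x = x + t • u x := hbij.1 (by
          change x + t • u x = (x + t • u x) + t • u (x + t • u x)
          simp [hu0 _ hy])
        exact hy (mem_of_eq_of_mem this.symm hx)
      · intro y hy
        obtain ⟨x, hx⟩ := hbij.2 y
        by_cases hxB : x ∈ closedBall (0 : 𝔼) 1
        · exact ⟨x, hxB, hx⟩
        · simp only [hu0 _ hxB, smul_zero, add_zero] at hx
          exact absurd (hx ▸ hy) hxB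
    have hderiv : ∀ x ∈ closedBall (0 : 𝔼) 1, HasFDerivWithinAt (fun x => x + t • u x)
        (ContinuousLinearMap.id ℝ 𝔼 + t • fderiv ℝ u x) (closedBall 0 1) x := fun x _ =>
      ((hasFDerivAt_id x).add
        ((hu.differentiable one_ne_zero x).hasFDerivAt.const_smul t)).hasFDerivWithinAt
    have := integral_image_eq_integral_abs_det_fderiv_smul volume measurableSet_closedBall
      hderiv hbij.1.injOn fun y => p.eval (‖y‖ ^ 2)
    rw [himg] at this
    rw [this, hJ]
    refine setIntegral_congr_fun measurableSet_closedBall fun x hx => ?_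
    simp only [smul_eq_mul]
    rw [abs_of_pos (ht1 x hx), mul_comm]
  have hJconst : J = C (∫ x in closedBall (0 : 𝔼) 1, p.eval (‖x‖ ^ 2)) := by
    refine eq_of_infinite_eval_eq _ _ (Set.Infinite.mono (s := {t | J.eval t = _}) ?_
      (infinite_of_mem_nhds 0 hloc))
    intro t ht
    simpa using ht
  have h1 := hJ 1
  rw [hJconst, eval_C] at h1
  simpa using h1.symm

/-- Otherwise, for a function `β` of the squared norm supported in the ball of radius `1/2`, the
Jacobian integral of `β` along `x + u(x)` vanishes, while its integral over the unit ball is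
positive. Weierstrass approximation transfers the polynomial identity to `β`. -/
lemma exists_det_ne_zero_of_norm_le_half {u : 𝔼 → 𝔼} (hu : ContDiff ℝ 1 u)
    (hu0 : ∀ x, x ∉ closedBall (0 : 𝔼) 1 → u x = 0) :
    ∃ x ∈ closedBall (0 : 𝔼) 1, ‖x + u x‖ < 1 / 2 ∧
      (ContinuousLinearMap.id ℝ 𝔼 + fderiv ℝ u x).det ≠ 0 := by
  by_contra! hcon
  have hB : IsCompact (closedBall (0 : 𝔼) 1) := isCompact_closedBall _ _
  have hcont := hu.continuous_fderiv one_ne_zero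
  have huc := hu.continuous
  have hdc : Continuous fun x : 𝔼 => (ContinuousLinearMap.id ℝ 𝔼 + fderiv ℝ u x).det :=
    ContinuousLinearMap.continuous_det.comp (by fun_prop)
  have hnc : Continuous fun x : 𝔼 => ‖x + u x‖ ^ 2 := by fun_prop
  obtain ⟨R, hR⟩ := hB.exists_bound_of_continuousOn hnc.continuousOn
  obtain ⟨m, hm⟩ := hB.exists_bound_of_continuousOn hdc.continuousOn
  set V := volume.real (closedBall (0 : 𝔼) 1)
  let β : ℝ → ℝ := fun s => max 0 (1 / 4 - s)
  have hβ : Continuous β := by fun_prop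
  have hβ0 : ∀ s, 0 ≤ β s := fun s => le_max_left _ _
  set I := ∫ x in closedBall (0 : 𝔼) 1, β (‖x‖ ^ 2)
  have hI : 0 < I := by
    have hc : Continuous fun x : 𝔼 => β (‖x‖ ^ 2) := by fun_prop
    rw [setIntegral_pos_iff_support_of_nonneg_ae (Filter.Eventually.of_forall fun x => hβ0 _)
      (hc.continuousOn.integrableOn_compact hB)]
    refine lt_of_lt_of_le (measure_ball_pos volume (0 : 𝔼) (r := 1 / 2) (by norm_num))
      (measure_mono fun x hx => ?_)
    rw [mem_ball_zero_iff] at hx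
    refine ⟨?_, by rw [mem_closedBall_zero_iff]; linarith⟩
    have : ‖x‖ ^ 2 < 1 / 4 := by nlinarith [norm_nonneg x]
    simp only [Function.mem_support, β]
    exact (lt_max_of_lt_right (by linarith)).ne'
  have hkey : ∀ η > 0, I ≤ η * (V + m * V) := by
    intro η hη
    -- The interval contains both `‖x‖ ^ 2` and `‖x + u x‖ ^ 2` for `x` in the ball.
    obtain ⟨p, hp⟩ := exists_polynomial_near_of_continuousOn 0 (max R 1) β hβ.continuousOn η hη
    have h1 : |I - ∫ x in closedBall (0 : 𝔼) 1, p.eval (‖x‖ ^ 2)| ≤ η * V := by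
      rw [← integral_sub, ← Real.norm_eq_abs]
      · refine norm_setIntegral_le_of_norm_le_const hB.measure_lt_top fun x hx => ?_
        rw [mem_closedBall_zero_iff] at hx
        rw [Real.norm_eq_abs, abs_sub_comm]
        refine (hp _ ⟨by positivity, le_max_of_le_right ?_⟩).le
        nlinarith [norm_nonneg x]
      · exact (show Continuous fun x : 𝔼 => β (‖x‖ ^ 2) by
          fun_prop).continuousOn.integrableOn_compact hB
      · exact (show Continuous fun x : 𝔼 => p.eval (‖x‖ ^ 2) by
          fun_prop).continuousOn.integrableOn_compact hB
    have h2 : |∫ x in closedBall (0 : 𝔼) 1, p.eval (‖x + u x‖ ^ 2) *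
        (ContinuousLinearMap.id ℝ 𝔼 + fderiv ℝ u x).det| ≤ η * m * V := by
      rw [← Real.norm_eq_abs]
      refine norm_setIntegral_le_of_norm_le_const hB.measure_lt_top fun x hx => ?_
      have hm0 := hm x hx
      have hpx := hp (‖x + u x‖ ^ 2) ⟨by positivity, le_max_of_le_left (by
        simpa using hR x hx)⟩
      by_cases hlt : ‖x + u x‖ < 1 / 2
      · simp only [hcon x hx hlt, mul_zero, norm_zero]
        exact mul_nonneg hη.le ((norm_nonneg _).trans hm0)
      · have : β (‖x + u x‖ ^ 2) = 0 := max_eq_left (by nlinarith)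
        rw [this, sub_zero] at hpx
        rw [norm_mul]
        exact mul_le_mul hpx.le hm0 (norm_nonneg _) hη.le
    rw [integral_comp_add_eq hu hu0] at h2
    have := abs_le.1 h1
    have := abs_le.1 h2
    nlinarith
  have hlim : Filter.Tendsto (fun η : ℝ => η * (V + m * V)) (nhdsWithin 0 (Ioi 0)) (nhds 0) := by
    have : Continuous fun η : ℝ => η * (V + m * V) := by fun_prop
    simpa using (this.tendsto 0).mono_left nhdsWithin_le_nhds
  exact absurd (ge_of_tendsto hlim (eventually_mem_nhdsWithin.mono hkey)) (not_le.2 hI)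

/-- A continuously differentiable map close to the identity is a submersion somewhere. -/
lemma exists_fderiv_det_ne_zero {G : 𝔼 → 𝔼} (hG : ContDiff ℝ 1 G)
    (hG1 : ∀ x ∈ closedBall (0 : 𝔼) 1, ‖G x - x‖ ≤ 1 / 4) : ∃ x, (fderiv ℝ G x).det ≠ 0 := by
  -- Since `3/4 = 1/2 + 1/4`, the point found below lies where `χ = 1`, so `G` is `id + u` near it.
  let χ : ContDiffBump (0 : 𝔼) := ⟨3 / 4, 1, by norm_num, by norm_num⟩
  let u : 𝔼 → 𝔼 := fun x => χ x • (G x - x)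
  have hu : ContDiff ℝ 1 u := χ.contDiff.smul (hG.sub contDiff_id)
  have hχ0 : ∀ x, x ∉ closedBall (0 : 𝔼) 1 → χ x = 0 := fun x hx =>
    χ.zero_of_le_dist (by simpa [χ] using (not_le.1 (mt mem_closedBall_zero_iff.2 hx)).le)
  obtain ⟨x, hx, hlt, hdet⟩ := exists_det_ne_zero_of_norm_le_half hu
    fun x hx => by simp [u, hχ0 x hx]
  refine ⟨x, ?_⟩
  have hux : ‖u x‖ ≤ 1 / 4 := by
    rw [norm_smul, Real.norm_of_nonneg χ.nonneg]
    have := hG1 x hx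
    nlinarith [χ.nonneg (x := x), χ.le_one (x := x), norm_nonneg (G x - x)]
  have hx34 : x ∈ ball (0 : 𝔼) (3 / 4) := by
    rw [mem_ball_zero_iff]
    have : ‖x‖ ≤ ‖x + u x‖ + ‖u x‖ := by
      simpa using norm_sub_le (x + u x) (u x)
    linarith
  have hev : G =ᶠ[nhds x] fun y => y + u y := by
    filter_upwards [isOpen_ball.mem_nhds hx34] with y hy
    have : χ y = 1 := χ.one_of_mem_closedBall (ball_subset_closedBall hy)
    simp [u, this]
  have : fderiv ℝ G x = ContinuousLinearMap.id ℝ 𝔼 + fderiv ℝ u x := by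
    rw [hev.fderiv_eq]
    exact ((hasFDerivAt_id x).add (hu.differentiable one_ne_zero x).hasFDerivAt).fderiv
  rwa [this]

/-- There is no continuous injection of `ℝᵏ` into a space of smaller dimension. -/
theorem not_injective_of_continuous_of_finrank_lt {F : Type} [NormedAddCommGroup F]
    [NormedSpace ℝ F] [FiniteDimensional ℝ F] (hF : Module.finrank ℝ F < k) {f : 𝔼 → F}
    (hf : Continuous f) : ¬ Function.Injective f := by
  intro hinj
  have hB : IsCompact (closedBall (0 : 𝔼) 1) := isCompact_closedBall _ _
  have : CompactSpace (closedBall (0 : 𝔼) 1) := isCompact_iff_compactSpace.1 hB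
  let e : closedBall (0 : 𝔼) 1 → F := fun x => f x
  have he : Continuous e := hf.comp continuous_subtype_val
  have hcl : Topology.IsClosedEmbedding e :=
    he.isClosedEmbedding fun a b h => Subtype.ext (hinj h)
  have : TietzeExtension.{0, 0} 𝔼 := TietzeExtension.of_tvs ℝ
  -- `H` extends the inverse of `f` on the ball to all of `F`. After smoothing, `H' ∘ f'` is close
  -- to the identity on the ball, yet its derivative factors through the smaller space `F`.
  obtain ⟨H, hH⟩ := ContinuousMap.exists_extension' hcl
    (⟨Subtype.val, continuous_subtype_val⟩ : C(closedBall (0 : 𝔼) 1, 𝔼))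
  have hHf : ∀ x ∈ closedBall (0 : 𝔼) 1, H (f x) = x := fun x hx => congrFun hH ⟨x, hx⟩
  obtain ⟨H', hH', hHH', -⟩ := H.continuous.exists_contDiff_approx (ε := fun _ => 1 / 8) 1
    continuous_const fun _ => by norm_num
  have hK : IsCompact (cthickening 1 (f '' closedBall (0 : 𝔼) 1)) :=
    (hB.image hf).cthickening
  obtain ⟨δ, hδ, hunif⟩ := Metric.uniformContinuousOn_iff.1
    (hK.uniformContinuousOn_of_continuous hH'.continuous.continuousOn) (1 / 8) (by norm_num)
  -- The bound `1` keeps `f'` in the compact thickening on which `δ` is valid; the two errors `1/8`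
  -- add up to `1/4`.
  obtain ⟨f', hf', hff', -⟩ := hf.exists_contDiff_approx (ε := fun _ => min δ 1) 1
    continuous_const fun _ => lt_min hδ one_pos
  obtain ⟨x, hx⟩ := exists_fderiv_det_ne_zero (G := H' ∘ f') (hH'.comp hf') fun x hx => by
    have hfx : f x ∈ f '' closedBall (0 : 𝔼) 1 := mem_image_of_mem f hx
    have h1 := hunif (f' x)
      (mem_cthickening_of_dist_le _ _ _ _ hfx ((hff' x).le.trans (min_le_right _ _))) (f x)
      (self_subset_cthickening _ hfx) ((hff' x).trans_le (min_le_left _ _))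
    have h2 := hHH' (f x)
    rw [hHf x hx] at h2
    rw [← dist_eq_norm]
    have := dist_triangle (H' (f' x)) (H' (f x)) x
    simp only [Function.comp_apply]
    linarith
  rw [fderiv_comp x (hH'.differentiable one_ne_zero _) (hf'.differentiable one_ne_zero _)] at hx
  have hker : LinearMap.ker (fderiv ℝ f' x : 𝔼 →ₗ[ℝ] F) ≠ ⊥ :=
    LinearMap.ker_ne_bot_of_finrank_lt (by simpa using hF)
  obtain ⟨y, hy, hy0⟩ := Submodule.exists_mem_ne_zero_of_ne_bot hker
  refine hx (LinearMap.det_eq_zero_iff_ker_ne_bot.2 fun h => hy0 ?_)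
  refine LinearMap.ker_eq_bot'.1 h y ?_
  have hy' : fderiv ℝ f' x y = 0 := hy
  simp [hy']

end Topology

/-- There is no continuous injection of a sphere into a sphere of smaller dimension. -/
theorem not_injective_sphere_of_finrank_lt {E F : Type} [NormedAddCommGroup E]
    [InnerProductSpace ℝ E] [FiniteDimensional ℝ E] [NormedAddCommGroup F] [InnerProductSpace ℝ F]
    [FiniteDimensional ℝ F] (hEF : Module.finrank ℝ F < Module.finrank ℝ E)
    {f : Metric.sphere (0 : E) 1 → Metric.sphere (0 : F) 1} (hf : Continuous f) :
    ¬ Function.Injective f := by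
  intro hinj
  obtain ⟨k, hk⟩ : ∃ k, Module.finrank ℝ E = k + 1 :=
    Nat.exists_eq_add_one_of_ne_zero (by lia)
  have : Fact (Module.finrank ℝ E = k + 1) := ⟨hk⟩
  have : Nontrivial E := Module.nontrivial_of_finrank_pos (R := ℝ) (by lia)
  obtain ⟨a⟩ : Nonempty (Metric.sphere (0 : E) 1) :=
    (NormedSpace.sphere_nonempty.2 zero_le_one).to_subtype
  have hb : ‖(f a : F)‖ = 1 := by simp
  let φ := stereographic' k a
  let ψ := stereographic hb
  have hmem : ∀ y, φ.symm y ≠ a := fun y => by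
    have := φ.map_target (x := y) (by simp [φ])
    simpa [φ] using this
  have hmem' : ∀ y, f (φ.symm y) ∈ ψ.source := fun y => by
    simp only [ψ, stereographic_source, Set.mem_compl_iff, Set.mem_singleton_iff]
    exact fun h => hmem y (hinj h)
  have hφ : Continuous φ.symm := by
    have := φ.continuousOn_symm
    rwa [stereographic'_target, continuousOn_univ] at this
  -- Deleting `a` and `f a` turns `f` into an injection between the stereographic charts.
  refine not_injective_of_continuous_of_finrank_lt (k := k) (F := (ℝ ∙ (f a : F))ᗮ)
    (f := fun y => ψ (f (φ.symm y))) ?_ ?_ ?_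
  · have h0 : (f a : F) ≠ 0 := fun h => by simp [h] at hb
    have h1 := finrank_span_singleton (K := ℝ) h0
    have h2 := (ℝ ∙ (f a : F)).finrank_add_finrank_orthogonal
    lia
  · exact ψ.continuousOn.comp_continuous (hf.comp hφ) hmem'
  · intro y y' h
    have h1 := hinj (ψ.injOn (hmem' y) (hmem' y') h)
    exact φ.symm.injOn (by simp [φ]) (by simp [φ]) h1

/-! ### Linear algebra in signature `(2, n)` -/

namespace AdS

variable {n : ℕ}

/-- The negative part of a vector of `ℝ^{2,n}`. -/
noncomputable def timePart : R2n n →ₗ[ℝ] EuclideanSpace ℝ (Fin 2) where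
  toFun x := WithLp.toLp 2 fun i => x (Sum.inl i)
  map_add' _ _ := rfl
  map_smul' _ _ := rfl

/-- The positive part of a vector of `ℝ^{2,n}`. -/
noncomputable def spacePart : R2n n →ₗ[ℝ] EuclideanSpace ℝ (Fin n) where
  toFun x := WithLp.toLp 2 fun i => x (Sum.inr i)
  map_add' _ _ := rfl
  map_smul' _ _ := rfl

@[simp] lemma timePart_apply (x : R2n n) (i : Fin 2) : timePart x i = x (Sum.inl i) := rfl

@[simp] lemma spacePart_apply (x : R2n n) (i : Fin n) : spacePart x i = x (Sum.inr i) := rfl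

lemma eq_zero_of_parts {x : R2n n} (h1 : timePart x = 0) (h2 : spacePart x = 0) : x = 0 := by
  ext (i | i)
  · exact congrArg (fun y : EuclideanSpace ℝ (Fin 2) => y i) h1
  · exact congrArg (fun y : EuclideanSpace ℝ (Fin n) => y i) h2

lemma form_eq_inner (x y : R2n n) :
    form x y = -inner ℝ (timePart x) (timePart y) + inner ℝ (spacePart x) (spacePart y) := by
  simp [form, PiLp.inner_apply, mul_comm]

lemma quad_eq_norm (x : R2n n) : quad x = -‖timePart x‖ ^ 2 + ‖spacePart x‖ ^ 2 := by
  rw [quad, form_eq_inner, real_inner_self_eq_norm_sq, real_inner_self_eq_norm_sq]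

lemma form_comm (x y : R2n n) : form x y = form y x := by
  rw [form_eq_inner, form_eq_inner, real_inner_comm, real_inner_comm (spacePart x)]

lemma form_add_left (x y z : R2n n) : form (x + y) z = form x z + form y z := by
  simp only [form_eq_inner, map_add, inner_add_left]; ring

lemma form_smul_left (c : ℝ) (x z : R2n n) : form (c • x) z = c * form x z := by
  simp only [form_eq_inner, map_smul, real_inner_smul_left]; ring

lemma form_add_right (x y z : R2n n) : form z (x + y) = form z x + form z y := by
  simp only [form_eq_inner, map_add, inner_add_right]; ring

lemma form_smul_right (c : ℝ) (x z : R2n n) : form z (c • x) = c * form z x := by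
  simp only [form_eq_inner, map_smul, real_inner_smul_right]; ring

lemma form_sub_right (x y z : R2n n) : form z (x - y) = form z x - form z y := by
  simp only [form_eq_inner, map_sub, inner_sub_right]; ring

lemma form_neg_right (x z : R2n n) : form z (-x) = -form z x := by
  simp only [form_eq_inner, map_neg, inner_neg_right]; ring

@[simp] lemma form_zero_right (z : R2n n) : form z 0 = 0 := by
  simp [form_eq_inner]

lemma quad_add (x y : R2n n) : quad (x + y) = quad x + 2 * form x y + quad y := by
  simp only [quad, form_add_left, form_add_right, form_comm y x]; ring

lemma quad_sub (x y : R2n n) : quad (x - y) = quad x - 2 * form x y + quad y := by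
  rw [sub_eq_add_neg, quad_add, form_neg_right]
  simp only [quad, form_neg_right, form_comm (-y)]; ring

lemma quad_smul (c : ℝ) (x : R2n n) : quad (c • x) = c ^ 2 * quad x := by
  simp only [quad, form_smul_left, form_smul_right]; ring

/-- Since the form has signature `(2, n)`, it is positive definite on the orthogonal of a
negative definite plane. -/
lemma quad_pos_of_orthogonal {v x w : R2n n} (hv : quad v < 0) (hx : quad x < 0)
    (hvx : form v x = 0) (hvw : form v w = 0) (hxw : form x w = 0) (hw : w ≠ 0) : 0 < quad w := by
  by_contra! hq
  let T : (Fin 3 → ℝ) →ₗ[ℝ] R2n n := Fintype.linearCombination ℝ ![v, x, w]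
  have hT : ∀ c, T c = c 0 • v + c 1 • x + c 2 • w := fun c => by
    simp [T, Fintype.linearCombination_apply, Fin.sum_univ_three]
  -- Three coefficients against two negative coordinates: some nontrivial combination has zero
  -- negative part, hence `quad ≥ 0`.
  have hker : LinearMap.ker (timePart ∘ₗ T) ≠ ⊥ :=
    LinearMap.ker_ne_bot_of_finrank_lt (by simp)
  obtain ⟨c, hc, hc0⟩ := Submodule.exists_mem_ne_zero_of_ne_bot hker
  have htime : timePart (T c) = 0 := hc
  have h1 : quad (T c) = c 0 ^ 2 * quad v + c 1 ^ 2 * quad x + c 2 ^ 2 * quad w := by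
    rw [hT, quad_add, quad_add, quad_smul, quad_smul, quad_smul]
    simp only [form_add_left, form_smul_left, form_smul_right, hvx, hvw, hxw]; ring
  have h2 := quad_eq_norm (T c)
  rw [htime, norm_zero] at h2
  have h3 : c 0 = 0 := by
    by_contra h
    nlinarith [sq_nonneg ‖spacePart (T c)‖, sq_pos_of_ne_zero h, sq_nonneg (c 1), sq_nonneg (c 2)]
  have h4 : c 1 = 0 := by
    by_contra h
    nlinarith [sq_nonneg ‖spacePart (T c)‖, sq_pos_of_ne_zero h, sq_nonneg (c 0), sq_nonneg (c 2)]
  have h5 : c 2 ≠ 0 := fun h => hc0 (by ext i; fin_cases i <;> simp [h3, h4, h])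
  have hs : spacePart (T c) = 0 := by
    have : ‖spacePart (T c)‖ ^ 2 ≤ 0 := by
      rw [h3, h4] at h1
      nlinarith [sq_nonneg (c 2)]
    simpa using pow_eq_zero_iff two_ne_zero |>.1 (le_antisymm this (sq_nonneg _))
  have h6 := eq_zero_of_parts htime hs
  rw [hT, h3, h4] at h6
  simp [h5, hw] at h6

/-- A vector orthogonal to a nontimelike vector `v`, whose positive part is parallel to that of
`v`, is not spacelike. -/
lemma quad_nonpos_of_spacePart_eq_smul {v w : R2n n} (hv0 : v ≠ 0) (hv : 0 ≤ quad v)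
    (hvw : form v w = 0) {c : ℝ} (hw : spacePart w = c • spacePart v) : quad w ≤ 0 := by
  rw [quad_eq_norm] at hv ⊢
  rw [form_eq_inner, hw, real_inner_smul_right, real_inner_self_eq_norm_sq] at hvw
  rw [hw, norm_smul, mul_pow, Real.norm_eq_abs, sq_abs]
  -- Orthogonality turns Cauchy–Schwarz into `|c| ‖spacePart v‖² ≤ ‖timePart v‖ ‖timePart w‖`.
  have hcs := abs_real_inner_le_norm (timePart v) (timePart w)
  rw [show inner ℝ (timePart v) (timePart w) = c * ‖spacePart v‖ ^ 2 by linarith, abs_mul,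
    abs_of_nonneg (sq_nonneg ‖spacePart v‖)] at hcs
  have hle : ‖timePart v‖ ≤ ‖spacePart v‖ := by
    refine (pow_le_pow_iff_left₀ (norm_nonneg _) (norm_nonneg _) two_ne_zero).1 ?_
    linarith
  have hpos : 0 < ‖spacePart v‖ := by
    refine (norm_nonneg _).lt_of_ne fun h => hv0 ?_
    rw [← h] at hle
    exact eq_zero_of_parts (norm_le_zero_iff.1 hle) (norm_eq_zero.1 h.symm)
  have h1 : |c| * ‖spacePart v‖ ≤ ‖timePart w‖ := by
    have := mul_le_mul_of_nonneg_right hle (norm_nonneg (timePart w))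
    nlinarith
  have h2 := pow_le_pow_left₀ (by positivity) h1 2
  rw [mul_pow, sq_abs] at h2
  linarith

/-! ### Cones over sets of rays and their convex hulls -/

/-- The nonzero vectors whose rays belong to `Λ`. -/
def cone (Λ : Set (RaySphere n)) : Set (R2n n) := {x | ∃ hx : x ≠ 0, rayOfNeZero ℝ x hx ∈ Λ}

lemma smul_mem_cone {Λ : Set (RaySphere n)} {x : R2n n} (hx : x ∈ cone Λ) {c : ℝ} (hc : 0 < c) :
    c • x ∈ cone Λ := by
  obtain ⟨hx0, hx⟩ := hx
  have h0 : c • x ≠ 0 := smul_ne_zero hc.ne' hx0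
  refine ⟨h0, ?_⟩
  have : rayOfNeZero ℝ (c • x) h0 = rayOfNeZero ℝ x hx0 :=
    (ray_eq_iff h0 hx0).2 (SameRay.sameRay_pos_smul_left x hc)
  rwa [this]

/-- The normalized representative of a ray. -/
noncomputable def unitVec : RaySphere n → R2n n :=
  Quotient.lift (fun v : RayVector ℝ (R2n n) => ‖(v : R2n n)‖⁻¹ • (v : R2n n)) fun v w h =>
    (sameRay_iff_inv_norm_smul_eq_of_ne v.2 w.2).1 h

lemma unitVec_rayOfNeZero (v : R2n n) (hv : v ≠ 0) :
    unitVec (rayOfNeZero ℝ v hv) = ‖v‖⁻¹ • v := rfl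

lemma continuous_unitVec : Continuous (unitVec (n := n)) := by
  refine continuous_coinduced_dom.2 ?_
  have : Continuous fun v : {v : R2n n // v ≠ 0} => ‖(v : R2n n)‖⁻¹ • (v : R2n n) :=
    (continuous_subtype_val.norm.inv₀ fun v => norm_ne_zero_iff.2 v.2).smul continuous_subtype_val
  exact this

lemma unitVec_ne_zero (r : RaySphere n) : unitVec r ≠ 0 := by
  induction r using Module.Ray.ind with
  | h v hv =>
    rw [unitVec_rayOfNeZero]
    exact smul_ne_zero (inv_ne_zero (norm_ne_zero_iff.2 hv)) hv

lemma rayOfNeZero_unitVec (r : RaySphere n) : rayOfNeZero ℝ (unitVec r) (unitVec_ne_zero r) = r := by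
  induction r using Module.Ray.ind with
  | h v hv =>
    exact (ray_eq_iff _ _).2 (SameRay.sameRay_pos_smul_left v (inv_pos.2 (norm_pos_iff.2 hv)))

lemma unitVec_mem_cone {Λ : Set (RaySphere n)} {r : RaySphere n} (hr : r ∈ Λ) :
    unitVec r ∈ cone Λ := ⟨unitVec_ne_zero r, by rwa [rayOfNeZero_unitVec]⟩

/-- If the vectors of `Λ` span `ℝ^{2,n}`, the convex hull has nonempty interior. -/
lemma interior_conv_nonempty {Λ : Set (RaySphere n)} (hne : Λ.Nonempty)
    (hspan : Submodule.span ℝ (cone Λ) = ⊤) : (interior (conv Λ)).Nonempty := by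
  obtain ⟨r₀, hr₀⟩ := hne
  have haff : affineSpan ℝ (cone Λ) = ⊤ := by
    rw [AffineSubspace.affineSpan_eq_top_iff_vectorSpan_eq_top_of_nonempty ℝ _ _
      ⟨_, unitVec_mem_cone hr₀⟩, eq_top_iff, ← hspan, Submodule.span_le]
    intro x hx
    -- The cone contains both `2x` and `x`, whose difference is `x`.
    have := vsub_mem_vectorSpan ℝ (smul_mem_cone hx two_pos) hx
    simpa [two_smul] using this
  have hO : (interior (convexHull ℝ (cone Λ))).Nonempty :=
    interior_convexHull_nonempty_iff_affineSpan_eq_top.2 haff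
  have hopen : IsOpen (interior (convexHull ℝ (cone Λ)) \ {0}) :=
    isOpen_interior.sdiff isClosed_singleton
  obtain ⟨w, hw, hw0⟩ : (interior (convexHull ℝ (cone Λ)) \ {0}).Nonempty := by
    rw [Set.nonempty_iff_ne_empty]
    intro h
    have h1 : interior (convexHull ℝ (cone Λ)) ⊆ {0} := Set.sdiff_eq_empty.1 h
    have h2 : interior (convexHull ℝ (cone Λ)) = {0} := (hO.subset_singleton_iff).1 h1
    exact not_isOpen_singleton (0 : R2n n) (h2 ▸ isOpen_interior)
  replace hw0 : w ≠ 0 := hw0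
  -- `U` consists of the rays that meet the interior of the hull in `ℝ^{2,n}`.
  let U : Set (RaySphere n) := ⋃ c ∈ Set.Ioi (0 : ℝ),
    (fun r => c • unitVec r) ⁻¹' interior (convexHull ℝ (cone Λ))
  have hU : IsOpen U := isOpen_biUnion fun c _ =>
    isOpen_interior.preimage (continuous_unitVec.const_smul c)
  refine ⟨rayOfNeZero ℝ w hw0, interior_maximal ?_ hU ?_⟩
  · intro r hr
    simp only [U, Set.mem_iUnion, Set.mem_preimage] at hr
    obtain ⟨c, hc, hr⟩ := hr
    refine ⟨c • unitVec r, smul_ne_zero (ne_of_gt hc) (unitVec_ne_zero r), interior_subset hr, ?_⟩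
    conv_lhs => rw [← rayOfNeZero_unitVec r]
    exact ((ray_eq_iff _ _).2 (SameRay.sameRay_pos_smul_left _ hc)).symm
  · simp only [U, Set.mem_iUnion, Set.mem_preimage]
    refine ⟨‖w‖, norm_pos_iff.2 hw0, ?_⟩
    rwa [unitVec_rayOfNeZero, smul_smul, mul_inv_cancel₀ (norm_ne_zero_iff.2 hw0), one_smul]

lemma exists_form_eq_zero_of_span_ne_top {s : Set (R2n n)} (hs : Submodule.span ℝ s ≠ ⊤) :
    ∃ v : R2n n, v ≠ 0 ∧ ∀ x ∈ s, form v x = 0 := by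
  obtain ⟨f, hf0, hf⟩ := Submodule.exists_le_ker_of_lt_top _ (lt_top_iff_ne_top.2 hs)
  let v : R2n n := Sum.elim (fun i => -f fun j => if Sum.inl i = j then 1 else 0)
    fun i => f fun j => if Sum.inr i = j then 1 else 0
  have hfv : ∀ x, f x = form v x := fun x => by
    rw [LinearMap.pi_apply_eq_sum_univ f x]
    simp [form, v, Fintype.sum_sum_type, mul_comm]
  refine ⟨v, fun h => hf0 ?_, fun x hx => ?_⟩
  · refine LinearMap.ext fun x => ?_
    rw [hfv, h, form_comm, form_zero_right, LinearMap.zero_apply]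
  · rw [← hfv]
    exact hf (Submodule.subset_span hx)

/-! ### Acausality as a sign condition on the form -/

lemma norm_sq_smul_add_smul {E : Type*} [NormedAddCommGroup E] [InnerProductSpace ℝ E] {x w : E}
    (hx : ‖x‖ = 1) (hw : ‖w‖ = 1) (hxw : inner ℝ x w = 0) (a b : ℝ) :
    ‖a • x + b • w‖ ^ 2 = a ^ 2 + b ^ 2 := by
  rw [norm_add_sq_real, norm_smul, norm_smul, real_inner_smul_left, real_inner_smul_right, hx, hw,
    hxw]
  simp

/-- Two points of a unit sphere lie on a great circle. -/
lemma exists_orthogonal_unit_of_unit {E : Type*} [NormedAddCommGroup E] [InnerProductSpace ℝ E]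
    [FiniteDimensional ℝ E] (hE : 2 ≤ Module.finrank ℝ E) {x y : E} (hx : ‖x‖ = 1)
    (hy : ‖y‖ = 1) : ∃ w : E, ‖w‖ = 1 ∧ inner ℝ x w = 0 ∧
      y = Real.cos (InnerProductGeometry.angle x y) • x +
        Real.sin (InnerProductGeometry.angle x y) • w := by
  set α := InnerProductGeometry.angle x y
  have hc : Real.cos α = inner ℝ x y := by
    simp [α, InnerProductGeometry.cos_angle, hx, hy]
  have hxx : inner ℝ x x = (1 : ℝ) := by rw [real_inner_self_eq_norm_sq, hx, one_pow]
  have hs : ‖y - Real.cos α • x‖ ^ 2 = Real.sin α ^ 2 := by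
    rw [norm_sub_sq_real, norm_smul, real_inner_smul_right, hx, hy, real_inner_comm, ← hc,
      Real.norm_eq_abs, mul_one, sq_abs]
    nlinarith [Real.sin_sq_add_cos_sq α]
  by_cases h0 : Real.sin α = 0
  · obtain ⟨w, hw, hw0⟩ : ∃ w ∈ (ℝ ∙ x)ᗮ, w ≠ 0 := by
      refine Submodule.exists_mem_ne_zero_of_ne_bot fun h => ?_
      have h1 := finrank_span_singleton (K := ℝ) (v := x) (fun h => by simp [h] at hx)
      have h2 := (ℝ ∙ x).finrank_add_finrank_orthogonal
      rw [h, finrank_bot] at h2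
      lia
    refine ⟨‖w‖⁻¹ • w, norm_smul_inv_norm hw0, ?_, ?_⟩
    · rw [real_inner_smul_right, Submodule.mem_orthogonal_singleton_iff_inner_right.1 hw, mul_zero]
    · rw [h0, zero_smul, add_zero]
      rw [h0] at hs
      simpa [sub_eq_zero] using hs
  · refine ⟨(Real.sin α)⁻¹ • (y - Real.cos α • x), ?_, ?_, ?_⟩
    · rw [← pow_left_inj₀ (norm_nonneg _) zero_le_one two_ne_zero, norm_smul, mul_pow, hs,
        Real.norm_eq_abs, sq_abs]
      field_simp
    · rw [real_inner_smul_right, inner_sub_right, real_inner_smul_right, hxx, hc]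
      ring
    · rw [smul_smul, mul_inv_cancel₀ h0, one_smul]
      abel

/-- Follow a great circle at constant speed equal to the angle, with `θ` affine: the time speed is
nonzero and dominates the space speed. -/
lemma causallyJoined_of_angle_le (hn : 2 ≤ n) {P Q : ℝ × UnitSphere n} (hPQ : P ≠ Q)
    (h : InnerProductGeometry.angle P.2.1 Q.2.1 ≤ |Q.1 - P.1|) : CausallyJoined P Q := by
  have hx : ‖P.2.1‖ = 1 := by simp
  obtain ⟨w, hw, hxw, hy⟩ := exists_orthogonal_unit_of_unit (by simpa using hn) hx
    (show ‖Q.2.1‖ = 1 by simp)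
  set α := InnerProductGeometry.angle P.2.1 Q.2.1
  have hα : 0 ≤ α := InnerProductGeometry.angle_nonneg _ _
  have hne : Q.1 - P.1 ≠ 0 := by
    intro h0
    rw [h0, abs_zero] at h
    rw [le_antisymm h hα] at hy
    exact hPQ (Prod.ext (sub_eq_zero.1 h0).symm (Subtype.ext (by simpa using hy.symm)))
  have hθ : ∀ t, HasDerivAt (fun t : ℝ => P.1 + t * (Q.1 - P.1)) (Q.1 - P.1) t := fun t => by
    simpa using ((hasDerivAt_id t).mul_const (Q.1 - P.1)).const_add P.1
  have hd : ∀ t, HasDerivAt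
      (fun t : ℝ => Real.cos (t * α) • (P.2.1 : EuclideanSpace ℝ (Fin n)) + Real.sin (t * α) • w)
      ((-Real.sin (t * α) * α) • (P.2.1 : EuclideanSpace ℝ (Fin n)) +
        (Real.cos (t * α) * α) • w) t := fun t => by
    have h1 : HasDerivAt (fun t : ℝ => t * α) α t := by
      simpa using (hasDerivAt_id t).mul_const α
    exact (h1.cos.smul_const _).add (h1.sin.smul_const _)
  refine ⟨fun t => P.1 + t * (Q.1 - P.1),
    fun t => Real.cos (t * α) • P.2.1 + Real.sin (t * α) • w, by fun_prop, by fun_prop,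
    fun t _ => ?_, fun t _ => ⟨?_, ?_⟩, by simp, by simp, by simp, ?_⟩
  · rw [← pow_left_inj₀ (norm_nonneg _) zero_le_one two_ne_zero,
      norm_sq_smul_add_smul hx hw hxw, Real.cos_sq_add_sin_sq, one_pow]
  · rw [(hθ t).deriv]
    exact fun h0 => hne (congrArg Prod.fst h0)
  · rw [(hθ t).deriv, (hd t).deriv, norm_sq_smul_add_smul hx hw hxw]
    have h2 : α ^ 2 ≤ (Q.1 - P.1) ^ 2 := by
      rw [← sq_abs (Q.1 - P.1)]; exact pow_le_pow_left₀ hα h 2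
    nlinarith [Real.sin_sq_add_cos_sq (t * α)]
  · simpa using hy.symm

lemma form_einVector (P Q : ℝ × UnitSphere n) :
    form (einVector P) (einVector Q) = -Real.cos (P.1 - Q.1) + inner ℝ P.2.1 Q.2.1 := by
  simp [form, einVector, PiLp.inner_apply, Real.cos_sub, mul_comm]

lemma quad_einVector (P : ℝ × UnitSphere n) : quad (einVector P) = 0 := by
  rw [quad, form_einVector, real_inner_self_eq_norm_sq]
  simp

/-- Without a causal curve the time gap is smaller than the angle, which is at most `π`, and the
cosine is strictly decreasing on `[0, π]`. -/
lemma form_einVector_neg (hn : 2 ≤ n) {P Q : ℝ × UnitSphere n} (hPQ : P ≠ Q)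
    (h : ¬ CausallyJoined P Q) : form (einVector P) (einVector Q) < 0 := by
  have hlt : |Q.1 - P.1| < InnerProductGeometry.angle P.2.1 Q.2.1 :=
    not_le.1 fun h' => h (causallyJoined_of_angle_le hn hPQ h')
  have hcos := Real.cos_lt_cos_of_nonneg_of_le_pi (abs_nonneg _)
    (InnerProductGeometry.angle_le_pi _ _) hlt
  rw [InnerProductGeometry.cos_angle, Real.cos_abs, ← Real.cos_neg, neg_sub] at hcos
  rw [form_einVector]
  simp only [norm_eq_of_mem_sphere, mul_one, div_one] at hcos
  linarith

variable {Λ : Set (RaySphere n)}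

lemma exists_eq_smul_einVector {L : Set (ℝ × UnitSphere n)} (hL : einProj '' L = Λ) {p : R2n n}
    (hp : p ∈ cone Λ) : ∃ P ∈ L, ∃ c : ℝ, 0 < c ∧ p = c • einVector P := by
  obtain ⟨hp0, hp⟩ := hp
  rw [← hL] at hp
  obtain ⟨P, hP, h⟩ := hp
  obtain ⟨c, hc, h'⟩ := ((ray_eq_iff _ _).1 h).exists_pos_left (einVector_ne_zero P) hp0
  exact ⟨P, hP, c, hc, h'.symm⟩

lemma quad_eq_zero_of_mem_cone (hΛ : IsAcausal Λ) {p : R2n n} (hp : p ∈ cone Λ) : quad p = 0 := by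
  obtain ⟨L, -, hL⟩ := hΛ
  obtain ⟨P, -, c, -, rfl⟩ := exists_eq_smul_einVector hL hp
  rw [quad_smul, quad_einVector, mul_zero]

lemma form_neg_of_mem_cone (hn : 2 ≤ n) (hΛ : IsAcausal Λ) {p q : R2n n} (hp : p ∈ cone Λ)
    (hq : q ∈ cone Λ) (hpq : ¬ SameRay ℝ p q) : form p q < 0 := by
  obtain ⟨L, hac, hL⟩ := hΛ
  obtain ⟨P, hP, c, hc, rfl⟩ := exists_eq_smul_einVector hL hp
  obtain ⟨Q, hQ, d, hd, rfl⟩ := exists_eq_smul_einVector hL hq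
  have hPQ : P ≠ Q := by
    rintro rfl
    exact hpq (((SameRay.refl _).pos_smul_left hc).pos_smul_right hd)
  have := form_einVector_neg hn hPQ (hac P hP Q hQ hPQ)
  rw [form_smul_left, form_smul_right]
  exact mul_neg_of_pos_of_neg hc (mul_neg_of_pos_of_neg hd this)

lemma form_nonpos_of_mem_cone (hn : 2 ≤ n) (hΛ : IsAcausal Λ) {p q : R2n n} (hp : p ∈ cone Λ)
    (hq : q ∈ cone Λ) : form p q ≤ 0 := by
  by_cases h : SameRay ℝ p q
  · obtain ⟨c, -, rfl⟩ := h.exists_pos_left hp.1 hq.1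
    have := quad_eq_zero_of_mem_cone hΛ hp
    rw [form_smul_right, ← quad, this, mul_zero]
  · exact (form_neg_of_mem_cone hn hΛ hp hq h).le

lemma exists_not_sameRay (hn : 2 ≤ n) (hsph : Nonempty (Λ ≃ₜ UnitSphere n)) :
    ∃ p ∈ cone Λ, ∃ q ∈ cone Λ, ¬ SameRay ℝ p q := by
  obtain ⟨e⟩ := hsph
  have : Nontrivial (EuclideanSpace ℝ (Fin n)) :=
    Module.nontrivial_of_finrank_pos (R := ℝ) (by simp; lia)
  obtain ⟨x, hx⟩ : (Metric.sphere (0 : EuclideanSpace ℝ (Fin n)) 1).Nonempty :=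
    NormedSpace.sphere_nonempty.2 zero_le_one
  have hxn : (⟨x, hx⟩ : UnitSphere n) ≠ -⟨x, hx⟩ := (ne_neg_of_mem_unit_sphere ℝ (⟨x, hx⟩ :
    Metric.sphere (0 : EuclideanSpace ℝ (Fin n)) 1))
  refine ⟨_, unitVec_mem_cone (e.symm ⟨x, hx⟩).2, _, unitVec_mem_cone (e.symm (-⟨x, hx⟩)).2,
    fun h => hxn (e.symm.injective (Subtype.ext ?_))⟩
  rw [← rayOfNeZero_unitVec (e.symm ⟨x, hx⟩).1, ← rayOfNeZero_unitVec (e.symm (-⟨x, hx⟩)).1]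
  exact (ray_eq_iff _ _).2 h

/-! ### Vectors orthogonal to an acausal sphere -/

/-- A nonzero vector orthogonal to an acausal topological sphere is timelike. -/
theorem quad_neg_of_orthogonal_cone (hn : 2 ≤ n) (hΛ : IsAcausal Λ)
    (hsph : Nonempty (Λ ≃ₜ UnitSphere n)) {v : R2n n} (hv0 : v ≠ 0)
    (hv : ∀ x ∈ cone Λ, form v x = 0) : quad v < 0 := by
  by_contra! hq
  obtain ⟨e⟩ := hsph
  set b := spacePart v with hb
  have hb0 : b ≠ 0 := by
    intro h
    rw [quad_eq_norm, ← hb, h, norm_zero] at hq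
    refine hv0 (eq_zero_of_parts ?_ h)
    have : ‖timePart v‖ ^ 2 ≤ 0 := by linarith
    simpa using le_antisymm this (sq_nonneg _)
  let π : EuclideanSpace ℝ (Fin n) →L[ℝ] (ℝ ∙ b)ᗮ := (ℝ ∙ b)ᗮ.orthogonalProjectionOnto
  have hπ : ∀ x, π x = 0 → ∃ c : ℝ, x = c • b := fun x hx => by
    have h1 : x ∈ (ℝ ∙ b)ᗮᗮ := Submodule.orthogonalProjectionOnto_eq_zero_iff.1 hx
    rw [Submodule.orthogonal_orthogonal] at h1
    obtain ⟨c, hc⟩ := Submodule.mem_span_singleton.1 h1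
    exact ⟨c, hc.symm⟩
  -- A vanishing projection would make `p` a multiple of `v`, hence orthogonal to all of `Λ`,
  -- against the strict sign for a second ray.
  have hne : ∀ p ∈ cone Λ, π (spacePart p) ≠ 0 := by
    intro p hp h0
    obtain ⟨c, hc⟩ := hπ _ h0
    have hw : p = c • v := by
      rw [← sub_eq_zero]
      have hs : spacePart (p - c • v) = 0 := by rw [map_sub, map_smul, hc, sub_self]
      have hqw : quad (p - c • v) = c ^ 2 * quad v := by
        rw [quad_sub, quad_smul, form_smul_right, form_comm p, hv p hp,
          quad_eq_zero_of_mem_cone hΛ hp]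
        ring
      have := quad_eq_norm (p - c • v)
      rw [hs, norm_zero, hqw] at this
      refine eq_zero_of_parts ?_ hs
      have : ‖timePart (p - c • v)‖ ^ 2 ≤ 0 := by
        have := mul_nonneg (sq_nonneg c) hq
        linarith
      simpa using le_antisymm this (sq_nonneg _)
    obtain ⟨x, hx, y, hy, hxy⟩ := exists_not_sameRay hn ⟨e⟩
    have hall : ∀ z ∈ cone Λ, SameRay ℝ p z := fun z hz => by
      by_contra h
      have := form_neg_of_mem_cone hn hΛ hp hz h
      rw [hw, form_smul_left, hv z hz, mul_zero] at this
      exact lt_irrefl _ this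
    exact hxy ((hall x hx).symm.trans (hall y hy) fun h => absurd h hp.1)
  let g : UnitSphere n → R2n n := fun s => unitVec (e.symm s).1
  have hg : ∀ s, g s ∈ cone Λ := fun s => unitVec_mem_cone (e.symm s).2
  have hgc : Continuous g :=
    continuous_unitVec.comp (continuous_subtype_val.comp e.symm.continuous)
  have hgπ : Continuous fun s => π (spacePart (g s)) :=
    π.continuous.comp ((LinearMap.continuous_of_finiteDimensional spacePart).comp hgc)
  let f : Metric.sphere (0 : EuclideanSpace ℝ (Fin n)) 1 → Metric.sphere (0 : (ℝ ∙ b)ᗮ) 1 :=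
    fun s => ⟨‖π (spacePart (g s))‖⁻¹ • π (spacePart (g s)), by
      rw [mem_sphere_zero_iff_norm]; exact norm_smul_inv_norm (hne _ (hg s))⟩
  refine not_injective_sphere_of_finrank_lt (f := f) ?_ ?_ ?_
  · have h1 := finrank_span_singleton (K := ℝ) hb0
    have h2 := (ℝ ∙ b).finrank_add_finrank_orthogonal
    exact (Nat.lt_add_of_pos_left (by rw [h1]; exact one_pos)).trans_eq h2
  · exact Continuous.subtype_mk ((hgπ.norm.inv₀ fun s => norm_ne_zero_iff.2 (hne _ (hg s))).smul
      hgπ) _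
  · intro s s' hss
    by_contra hne'
    have hray : ¬ SameRay ℝ (g s) (g s') := fun h => hne' <| e.symm.injective <| Subtype.ext <| by
      rw [← rayOfNeZero_unitVec (e.symm s).1, ← rayOfNeZero_unitVec (e.symm s').1]
      exact (ray_eq_iff _ _).2 h
    have hneg := form_neg_of_mem_cone hn hΛ (hg s) (hg s') hray
    have heq := congrArg Subtype.val hss
    simp only [f] at heq
    set r := ‖π (spacePart (g s))‖⁻¹ with hr
    set r' := ‖π (spacePart (g s'))‖⁻¹ with hr'
    have hr0 : 0 < r := inv_pos.2 (norm_pos_iff.2 (hne _ (hg s)))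
    have hr0' : 0 < r' := inv_pos.2 (norm_pos_iff.2 (hne _ (hg s')))
    obtain ⟨c, hc⟩ := hπ (spacePart (r • g s - r' • g s')) (by
      rw [map_sub, map_smul, map_smul, map_sub, map_smul, map_smul, heq, sub_self])
    -- For isotropic vectors this `quad` equals `-2 r r' form (g s) (g s')`, which is positive by
    -- acausality.
    have h1 := quad_nonpos_of_spacePart_eq_smul hv0 hq (w := r • g s - r' • g s') (by
      rw [form_sub_right, form_smul_right, form_smul_right, hv _ (hg s), hv _ (hg s')]; simp) hc
    rw [quad_sub, quad_smul, quad_smul, quad_eq_zero_of_mem_cone hΛ (hg s),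
      quad_eq_zero_of_mem_cone hΛ (hg s'), form_smul_left, form_smul_right] at h1
    have := mul_pos (mul_pos hr0 hr0') (neg_pos.2 hneg)
    nlinarith

end AdS

/-! ### The group action and the fixed point -/

namespace AdS

variable {n : ℕ} {Λ : Set (RaySphere n)}

lemma mulVec_mem_cone {g : GL (Fin 2 ⊕ Fin n) ℝ}
    (hg : Matrix.GeneralLinearGroup.toLin g • Λ = Λ) {x : R2n n} (hx : x ∈ cone Λ) :
    g.1 *ᵥ x ∈ cone Λ := by
  obtain ⟨hx0, hx⟩ := hx
  have h := Set.smul_mem_smul_set (a := Matrix.GeneralLinearGroup.toLin g) hx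
  rw [hg, smul_rayOfNeZero] at h
  exact ⟨_, h⟩

/-- The identity component of `SO(2,n)` preserves the orientation of negative definite planes. -/
lemma form_mul_form_sub_pos {v z : R2n n} (hv : quad v < 0) (hz : quad z < 0)
    (hvz : form v z = 0) {g : GL (Fin 2 ⊕ Fin n) ℝ} (hg : g ∈ SO2nZero n) :
    0 < form v (g.1 *ᵥ v) * form z (g.1 *ᵥ z) - form v (g.1 *ᵥ z) * form z (g.1 *ᵥ v) := by
  obtain ⟨h, hh, rfl⟩ := hg
  let D : SO2n n → ℝ := fun h => form v (h.1.1 *ᵥ v) * form z (h.1.1 *ᵥ z) -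
    form v (h.1.1 *ᵥ z) * form z (h.1.1 *ᵥ v)
  have hval : Continuous fun h : SO2n n => (h.1.1 : Matrix (Fin 2 ⊕ Fin n) (Fin 2 ⊕ Fin n) ℝ) :=
    Units.continuous_val.comp continuous_subtype_val
  have hform : ∀ x y : R2n n, Continuous fun h : SO2n n => form x (h.1.1 *ᵥ y) := fun x y => by
    have h1 : Continuous fun h : SO2n n => h.1.1 *ᵥ y := hval.matrix_mulVec continuous_const
    unfold form
    fun_prop
  have hD : Continuous D :=
    ((hform v v).mul (hform z z)).sub ((hform v z).mul (hform z v))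
  -- If `D h = 0`, some nonzero `w` in the plane of `v` and `z` is sent into the orthogonal of that
  -- plane, which is positive definite, although `quad w < 0`.
  have hne : ∀ h, D h ≠ 0 := by
    intro h hD0
    have hdet : (!![form v (h.1.1 *ᵥ v), form v (h.1.1 *ᵥ z);
        form z (h.1.1 *ᵥ v), form z (h.1.1 *ᵥ z)] : Matrix (Fin 2) (Fin 2) ℝ).det = 0 := by
      rw [Matrix.det_fin_two_of]; exact hD0
    obtain ⟨c, hc0, hc⟩ := Matrix.exists_mulVec_eq_zero_iff.2 hdet
    have e1 := congrFun hc 0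
    have e2 := congrFun hc 1
    simp only [Matrix.mulVec, dotProduct, Fin.sum_univ_two, Matrix.of_apply, Matrix.cons_val_zero,
      Matrix.cons_val_one, Pi.zero_apply] at e1 e2
    set w := c 0 • v + c 1 • z with hw
    have hgw : h.1.1 *ᵥ w = c 0 • (h.1.1 *ᵥ v) + c 1 • (h.1.1 *ᵥ z) := by
      rw [hw, Matrix.mulVec_add, Matrix.mulVec_smul, Matrix.mulVec_smul]
    have hqw : quad w = c 0 ^ 2 * quad v + c 1 ^ 2 * quad z := by
      rw [hw, quad_add, quad_smul, quad_smul, form_smul_left, form_smul_right, hvz]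
      ring
    have hqneg : quad w < 0 := by
      rw [hqw]
      by_cases h0 : c 0 = 0
      · have h1 : c 1 ≠ 0 := fun h1 => hc0 (by ext i; fin_cases i <;> simp [h0, h1])
        nlinarith [sq_pos_of_ne_zero h1]
      · nlinarith [sq_pos_of_ne_zero h0, sq_nonneg (c 1)]
    have hqgw : quad (h.1.1 *ᵥ w) = quad w := h.2.1 w w
    have hgw0 : h.1.1 *ᵥ w ≠ 0 := fun h0 => by
      rw [← hqgw, h0, quad, form_zero_right] at hqneg
      exact lt_irrefl _ hqneg
    have := quad_pos_of_orthogonal hv hz hvz (w := h.1.1 *ᵥ w)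
      (by rw [hgw, form_add_right, form_smul_right, form_smul_right]; linarith)
      (by rw [hgw, form_add_right, form_smul_right, form_smul_right]; linarith) hgw0
    linarith
  have h1 : 0 < D 1 := by
    simp only [D, OneMemClass.coe_one, Units.val_one, Matrix.one_mulVec]
    rw [hvz, zero_mul, sub_zero]
    exact mul_pos_of_neg_of_neg hv hz
  have hconn : IsPreconnected (D '' connectedComponent 1) :=
    isPreconnected_connectedComponent.image D hD.continuousOn
  by_contra! hle
  have hmem : (0 : ℝ) ∈ D '' connectedComponent 1 :=
    hconn.ordConnected.out ⟨h, hh, rfl⟩ ⟨1, mem_connectedComponent, rfl⟩ ⟨hle, h1.le⟩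
  obtain ⟨h', -, h0⟩ := hmem
  exact hne h' h0

/-- The vectors orthogonal to an acausal topological sphere form a line. -/
lemma eq_smul_of_orthogonal_cone (hn : 2 ≤ n) (hΛ : IsAcausal Λ)
    (hsph : Nonempty (Λ ≃ₜ UnitSphere n)) {v w : R2n n} (hv1 : quad v = -1)
    (hv : ∀ x ∈ cone Λ, form v x = 0) (hw : ∀ x ∈ cone Λ, form w x = 0) :
    w = -form v w • v := by
  obtain ⟨x, hx, y, hy, hxy⟩ := exists_not_sameRay hn hsph
  have hz : quad (x + y) < 0 := by
    rw [quad_add, quad_eq_zero_of_mem_cone hΛ hx, quad_eq_zero_of_mem_cone hΛ hy]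
    linarith [form_neg_of_mem_cone hn hΛ hx hy hxy]
  rw [← sub_eq_zero]
  set u := w - -form v w • v with hu
  have hcone : ∀ p ∈ cone Λ, form u p = 0 := fun p hp => by
    rw [form_comm, hu, form_sub_right, form_smul_right, form_comm p, form_comm p, hw p hp, hv p hp]
    ring
  by_contra hu0
  have h1 := quad_neg_of_orthogonal_cone hn hΛ hsph hu0 hcone
  have h2 := quad_pos_of_orthogonal (v := v) (x := x + y) (w := u) (by linarith) hz
    -- `u` is orthogonal to the negative definite plane of `v` and `x + y`, so it would be both
    -- spacelike and timelike.
    (by rw [form_add_right, hv x hx, hv y hy, add_zero])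
    (by rw [hu, form_sub_right, form_smul_right, ← quad, hv1]; ring)
    (by rw [form_comm, form_add_right, hcone x hx, hcone y hy, add_zero]) hu0
  linarith

/-- The image of `v` is again orthogonal to `Λ`, so it is `±v`. On the plane of `v` and `x + y`,
with `x`, `y` in the cone, the orientation determinant reduces to a product of two diagonal terms;
the one for `x + y` is nonpositive by acausality, which forces the sign `+`. -/
lemma mulVec_eq_self_of_orthogonal_cone (hn : 2 ≤ n) (hΛ : IsAcausal Λ)
    (hsph : Nonempty (Λ ≃ₜ UnitSphere n)) {v : R2n n} (hv1 : quad v = -1)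
    (hv : ∀ x ∈ cone Λ, form v x = 0) {g : GL (Fin 2 ⊕ Fin n) ℝ} (hg : g ∈ SO2nZero n)
    (hgΛ : Matrix.GeneralLinearGroup.toLin g • Λ = Λ) : g.1 *ᵥ v = v := by
  have hgform : ∀ x y, form (g.1 *ᵥ x) (g.1 *ᵥ y) = form x y := by
    obtain ⟨h, -, rfl⟩ := hg
    exact h.2.1
  have hginv : Matrix.GeneralLinearGroup.toLin g⁻¹ • Λ = Λ := by
    rw [map_inv, inv_smul_eq_iff, hgΛ]
  have hgg : ∀ x, g.1 *ᵥ ((g⁻¹).1 *ᵥ x) = x := fun x => by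
    rw [Matrix.mulVec_mulVec, ← Units.val_mul, mul_inv_cancel, Units.val_one, Matrix.one_mulVec]
  have hgv : ∀ x ∈ cone Λ, form (g.1 *ᵥ v) x = 0 := fun x hx => by
    rw [← hgg x, hgform]
    exact hv _ (mulVec_mem_cone hginv hx)
  have heq := eq_smul_of_orthogonal_cone hn hΛ hsph hv1 hv hgv
  obtain ⟨x, hx, y, hy, hxy⟩ := exists_not_sameRay hn hsph
  have hz : quad (x + y) < 0 := by
    rw [quad_add, quad_eq_zero_of_mem_cone hΛ hx, quad_eq_zero_of_mem_cone hΛ hy]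
    linarith [form_neg_of_mem_cone hn hΛ hx hy hxy]
  have hgx := mulVec_mem_cone hgΛ hx
  have hgy := mulVec_mem_cone hgΛ hy
  have hpos := form_mul_form_sub_pos (v := v) (z := x + y) (by linarith) hz
    (by rw [form_add_right, hv x hx, hv y hy, add_zero]) hg
  rw [Matrix.mulVec_add, form_add_right (g.1 *ᵥ x) _ v, hv _ hgx, hv _ hgy, add_zero, zero_mul,
    sub_zero] at hpos
  have hnonpos : form (x + y) (g.1 *ᵥ x + g.1 *ᵥ y) ≤ 0 := by
    rw [form_add_right, form_add_left, form_add_left]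
    linarith [form_nonpos_of_mem_cone hn hΛ hx hgx, form_nonpos_of_mem_cone hn hΛ hx hgy,
      form_nonpos_of_mem_cone hn hΛ hy hgx, form_nonpos_of_mem_cone hn hΛ hy hgy]
  set a := form v (g.1 *ᵥ v)
  have ha : a < 0 := by
    by_contra! h
    exact absurd hpos (not_lt.2 (mul_nonpos_of_nonneg_of_nonpos h hnonpos))
  have hq : quad (g.1 *ᵥ v) = -1 := by rw [quad, hgform, ← quad, hv1]
  rw [heq, quad_smul, hv1] at hq
  have ha1 : a = -1 := by nlinarith
  rw [heq, ha1, neg_neg, one_smul]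

lemma conv_subset_rayPerp {v : R2n n} (hv : ∀ x ∈ cone Λ, form v x = 0) :
    conv Λ ⊆ rayPerp v := by
  rintro r ⟨x, hx0, hx, rfl⟩
  refine ⟨x, hx0, ?_, rfl⟩
  have hconvex : Convex ℝ {y | form v y = 0} := fun y hy z hz a b _ _ _ => by
    have hy' : form v y = 0 := hy
    have hz' : form v z = 0 := hz
    simp [form_add_right, form_smul_right, hy', hz']
  exact convexHull_min (s := cone Λ) hv hconvex hx

lemma isSpacelikePerp_of_quad_neg {v : R2n n} (hv : quad v < 0) : IsSpacelikePerp v := by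
  intro x hx hvx w hvw hxw hw
  have hx' : quad x = -1 := hx
  exact quad_pos_of_orthogonal hv (by linarith) hvx hvw hxw hw

end AdS

theorem mainTheorem9 {n : ℕ} (hn : 2 ≤ n) {Γ : Type*} [Group Γ] (ρ : Γ →* AdS.SO2nZero n)
    (Λ : Set (AdS.RaySphere n)) (hρ : AdS.IsQuasiFuchsian ρ Λ)
    (hΛ : interior (AdS.conv Λ) = ∅) :
    AdS.IsFuchsian ρ ∧
      ∃ v : AdS.R2n n, AdS.IsGlobalFixedPoint ρ v ∧ AdS.IsSpacelikePerp v ∧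
        AdS.conv Λ ⊆ AdS.rayPerp v := by
  obtain ⟨hinj, hdisc, hsph, hac, hinv⟩ := hρ
  have hne : Λ.Nonempty := by
    obtain ⟨x, ⟨hx0, hx⟩, -⟩ := AdS.exists_not_sameRay hn hsph
    exact ⟨_, hx⟩
  have hspan : Submodule.span ℝ (AdS.cone Λ) ≠ ⊤ := fun h =>
    (AdS.interior_conv_nonempty hne h).ne_empty hΛ
  obtain ⟨v₀, hv₀, hv₀Λ⟩ := AdS.exists_form_eq_zero_of_span_ne_top hspan
  have hq := AdS.quad_neg_of_orthogonal_cone hn hac hsph hv₀ hv₀Λ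
  -- Normalization that brings the timelike vector `v₀` into `AdS_{n+1}`.
  set c := (Real.sqrt (-AdS.quad v₀))⁻¹
  have hv1 : AdS.quad (c • v₀) = -1 := by
    rw [AdS.quad_smul, inv_pow, Real.sq_sqrt (by linarith)]
    rw [inv_neg, neg_mul, inv_mul_cancel₀ hq.ne]
  have hv : ∀ x ∈ AdS.cone Λ, AdS.form (c • v₀) x = 0 := fun x hx => by
    rw [AdS.form_smul_left, hv₀Λ x hx, mul_zero]
  have hfix : AdS.IsGlobalFixedPoint ρ (c • v₀) := ⟨hv1, fun γ =>
    AdS.mulVec_eq_self_of_orthogonal_cone hn hac hsph hv1 hv (ρ γ).2 (hinv γ)⟩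
  exact ⟨⟨hinj, hdisc, _, hfix⟩, _, hfix, AdS.isSpacelikePerp_of_quad_neg (by linarith),
    AdS.conv_subset_rayPerp hv⟩
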